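/- **Setting.** Let $\mathfrak g$ be a finite-dimensional real semisimple Lie algebra with Killing form $\langle-,-\rangle$, and for $O\in \mathrm O(3)$ let $\sigma_O:\mathfrak g^3\to\mathfrak g^3$, $\sigma_O(a_1,a_2,a_3)=(a_1,a_2,a_3)O$. Put $l^j_\xi(a_1,a_2,a_3)=\langle\xi,a_j\rangle$. Let $U\subseteq\mathfrak g^3$ be an open subset invariant under $\sigma_O$, $O\in\mathrm{SO}(3)$ (for instance $U=\mathfrak g^3$), and let $A:U\to S^2(\mathfrak g)$ be smooth and $\mathrm{SO}(3)$-invariant; write $A_{\xi,\zeta}$ for its contraction with $\xi,\zeta\in\mathfrak g$ by the Killing form. Let $\pi_1$ be the bivector field on $U$ with $$\{l^1_\xi,l^1_\zeta\}=l^1_{[\xi,\zeta]},\quad \{l^1_\xi,l^2_\zeta\}=\{l^2_\xi,l^1_\zeta\}=l^2_{[\xi,\zeta]},\quad \{l^2_\xi,l^2_\zeta\}=-l^1_{[\xi,\zeta]},$$ $$\{l^1_\xi,l^3_\zeta\}=\{l^3_\xi,l^1_\zeta\}=l^3_{[\xi,\zeta]},\quad \{l^3_\xi,l^3_\zeta\}=-l^1_{[\xi,\zeta]},\quad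 \{l^2_\xi,l^3_\zeta\}=-\{l^3_\xi,l^2_\zeta\}=A_{\xi,\zeta},$$ and let $\pi_2=\sigma_*\pi_1$, $\pi_3=\sigma_*\pi_2$ with $\sigma(a_1,a_2,a_3)=(a_3,a_1,a_2)$. A *hypersymplectic structure* on a manifold is a triple of symplectic forms $(\omega_1,\omega_2,\omega_3)$ with $[(\omega_i^\flat)^{-1}\circ\omega_j^\flat]^2=-\mathrm{id}$ for all $i\ne j$. Call $(\pi_1,\pi_2,\pi_3)$ a *hyper-Lie Poisson structure* if $\pi_1$ is a Poisson tensor, the symplectic foliations of $\pi_1,\pi_2,\pi_3$ coincide (that is, the distributions $\pi_i^\sharp(T^*U)$ are equal), and on each symplectic leaf the forms induced by $\pi_1,\pi_2,\pi_3$ form a hypersymplectic structure. A diffeomorphism $F:\tilde M\to M$ between hypersymplectic manifolds is an *isomorphism* (an *anti-isomorphism*) if $F^*(\omega_1,\omega_2,\omega_3)=(\tilde\omega_1,\tilde\omega_2,\tilde\omega_3)R$ for some $R\in\mathrm O(3)$ with $\det R=1$ (respectively $\det R=-1$). **Theorem.** Let $(\pi_1,\pi_2,\pi_3)$ be a hyper-Lie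 Poisson structure on $U$, let $O\in\mathrm O(3)$, and if $\det O=-1$ assume moreover that $U=-U$ and $A(-a)=-A(a)$ for all $a\in U$. (Together with the $\mathrm{SO}(3)$-invariance this says that $A(aO)=\det(O)\,A(a)$.) Let $L$ be any symplectic leaf of $\pi_1$. Then $\sigma_O(L)$ is also a symplectic leaf of $\pi_1$, and $\sigma_O$ restricts to a diffeomorphism $L\to\sigma_O(L)$. Moreover, for the hypersymplectic structures induced on $L$ and $\sigma_O(L)$ by $(\pi_1,\pi_2,\pi_3)$: - if $\det O=1$, then $\sigma_O|_L:L\to\sigma_O(L)$ is an isomorphism of hypersymplectic structures; - if $\det O=-1$, then $\sigma_O|_L:L\to\sigma_O(L)$ is an anti-isomorphism of hypersymplectic structures. -/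

import Mathlib

open scoped Manifold ContDiff TensorProduct

namespace HyperLie

universe u

/-! ### Two-forms and hypersymplectic structures on manifolds -/

section Forms

variable {d : ℕ} {M : Type u} [TopologicalSpace M] [ChartedSpace (EuclideanSpace ℝ (Fin d)) M]

/-- A field of bilinear forms on the tangent spaces of a `d`-dimensional manifold `M`. Applied to
one vector it is the bundle map `Ω♭ : TM → T*M`, `Ω♭ v = Ω(v, ·)`. -/
abbrev BilinField (d : ℕ) (M : Type u) [TopologicalSpace M]
    [ChartedSpace (EuclideanSpace ℝ (Fin d)) M] : Type u :=
  (p : M) → (TangentSpace (𝓡 d) p →L[ℝ] TangentSpace (𝓡 d) p →L[ℝ] ℝ)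

/-- The expression of `Ω` in the chart at `p₀`: the pullback of `Ω` by the inverse chart. -/
noncomputable def chartForm (Ω : BilinField d M) (p₀ : M)
    (y u v : EuclideanSpace ℝ (Fin d)) : ℝ :=
  Ω ((extChartAt (𝓡 d) p₀).symm y)
    (mfderiv 𝓘(ℝ, EuclideanSpace ℝ (Fin d)) (𝓡 d) (extChartAt (𝓡 d) p₀).symm y u)
    (mfderiv 𝓘(ℝ, EuclideanSpace ℝ (Fin d)) (𝓡 d) (extChartAt (𝓡 d) p₀).symm y v)

/-- Smooth, alternating, nondegenerate and closed. Closedness is checked in charts, where for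
constant vector fields `dΩ(u,v,w) = ∂ᵤ Ω(v,w) + ∂ᵥ Ω(w,u) + ∂_w Ω(u,v)`. -/
structure IsSymplecticForm [IsManifold (𝓡 d) ∞ M] (Ω : BilinField d M) : Prop where
  smooth : ContMDiff (𝓡 d)
    ((𝓡 d).prod 𝓘(ℝ, EuclideanSpace ℝ (Fin d) →L[ℝ] EuclideanSpace ℝ (Fin d) →L[ℝ] ℝ)) ∞
    (fun p : M => Bundle.TotalSpace.mk'
      (EuclideanSpace ℝ (Fin d) →L[ℝ] EuclideanSpace ℝ (Fin d) →L[ℝ] ℝ)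
      (E := fun p : M => TangentSpace (𝓡 d) p →L[ℝ] TangentSpace (𝓡 d) p →L[ℝ] ℝ) p (Ω p))
  alternating : ∀ (p : M) (v : TangentSpace (𝓡 d) p), Ω p v v = 0
  nondegenerate : ∀ (p : M) (v : TangentSpace (𝓡 d) p), (∀ w, Ω p v w = 0) → v = 0
  closed : ∀ (p₀ : M), ∀ y ∈ (extChartAt (𝓡 d) p₀).target, ∀ u v w : EuclideanSpace ℝ (Fin d),
    fderiv ℝ (fun z => chartForm Ω p₀ z v w) y u
      + fderiv ℝ (fun z => chartForm Ω p₀ z w u) y v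
      + fderiv ℝ (fun z => chartForm Ω p₀ z u v) y w = 0

/-- Three symplectic forms with `((Ωᵢ♭)⁻¹ ∘ Ωⱼ♭)² = -id` for all `i ≠ j`. -/
structure IsHypersymplectic [IsManifold (𝓡 d) ∞ M] (Ω : Fin 3 → BilinField d M) : Prop where
  symplectic : ∀ i, IsSymplecticForm (Ω i)
  sq_eq_neg_id : ∀ i j, i ≠ j → ∀ (p : M) (v : TangentSpace (𝓡 d) p),
    ((Ω i p).inverse ∘L Ω j p) (((Ω i p).inverse ∘L Ω j p) v) = -v

variable {d' : ℕ} {M' : Type u} [TopologicalSpace M']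
  [ChartedSpace (EuclideanSpace ℝ (Fin d')) M']

/-- `F^*(Ω'₁, Ω'₂, Ω'₃) = (Ω₁, Ω₂, Ω₃) R`. -/
def PullsBackTo (F : M ≃ₘ⟮𝓡 d, 𝓡 d'⟯ M') (Ω : Fin 3 → BilinField d M)
    (Ω' : Fin 3 → BilinField d' M') (R : Matrix (Fin 3) (Fin 3) ℝ) : Prop :=
  ∀ (j : Fin 3) (p : M) (u v : TangentSpace (𝓡 d) p),
    Ω' j (F p) (mfderiv (𝓡 d) (𝓡 d') F p u) (mfderiv (𝓡 d) (𝓡 d') F p v)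
      = ∑ i, Ω i p u v * R i j

/-- Isomorphism of hypersymplectic structures `(M, Ω) → (M', Ω')`: a diffeomorphism that
intertwines the triples of forms up to an element of `SO(3)`. -/
def IsHypersymplecticIso (F : M ≃ₘ⟮𝓡 d, 𝓡 d'⟯ M') (Ω : Fin 3 → BilinField d M)
    (Ω' : Fin 3 → BilinField d' M') : Prop :=
  ∃ R ∈ Matrix.specialOrthogonalGroup (Fin 3) ℝ, PullsBackTo F Ω Ω' R

/-- Anti-isomorphism of hypersymplectic structures: as above, up to an element of `O(3)` of
determinant `-1`. -/
def IsHypersymplecticAntiIso (F : M ≃ₘ⟮𝓡 d, 𝓡 d'⟯ M') (Ω : Fin 3 → BilinField d M)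
    (Ω' : Fin 3 → BilinField d' M') : Prop :=
  ∃ R ∈ Matrix.orthogonalGroup (Fin 3) ℝ, R.det = -1 ∧ PullsBackTo F Ω Ω' R

end Forms

/-! ### Immersed submanifolds, bivector fields, symplectic leaves -/

/-- An immersed submanifold of `E`: a smooth manifold `M` with an injective immersion into `E`. -/
structure ImmersedSubmanifold (E : Type u) [NormedAddCommGroup E] [NormedSpace ℝ E] where
  dim : ℕ
  M : Type u
  [top : TopologicalSpace M]
  [charted : ChartedSpace (EuclideanSpace ℝ (Fin dim)) M]
  [manifold : IsManifold (𝓡 dim) ∞ M]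
  incl : M → E
  incl_injective : Function.Injective incl
  incl_smooth : ContMDiff (𝓡 dim) 𝓘(ℝ, E) ∞ incl
  incl_immersion : ∀ p : M, Function.Injective (mfderiv (𝓡 dim) 𝓘(ℝ, E) incl p)

attribute [instance] ImmersedSubmanifold.top ImmersedSubmanifold.charted
  ImmersedSubmanifold.manifold

section Poisson

variable {E : Type u} [NormedAddCommGroup E] [NormedSpace ℝ E]

/-- The underlying subset of `E`. -/
def ImmersedSubmanifold.toSet (N : ImmersedSubmanifold E) : Set E := Set.range N.incl

/-- The differential of the inclusion. -/
noncomputable def ImmersedSubmanifold.dincl (N : ImmersedSubmanifold E) (p : N.M) :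
    TangentSpace (𝓡 N.dim) p →L[ℝ] E :=
  mfderiv (𝓡 N.dim) 𝓘(ℝ, E) N.incl p

/-- A field of contravariant 2-tensors on the (finite-dimensional) space `E`, given by its sharp
map `π♯ : T*E → TE`, where `π(α, β) = β(π♯ α)`. -/
abbrev SharpField (E : Type u) [NormedAddCommGroup E] [NormedSpace ℝ E] : Type u :=
  E → ((E →L[ℝ] ℝ) →L[ℝ] E)

/-- `π` is a smooth bivector field on the open set `U`. -/
def IsBivectorFieldOn (π : SharpField E) (U : Set E) : Prop :=
  ContDiffOn ℝ ∞ π U ∧ ∀ x ∈ U, ∀ α β : E →L[ℝ] ℝ, β (π x α) = -α (π x β)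

/-- The bracket `{f, h} = π(df, dh)`. -/
noncomputable def bracket (π : SharpField E) (f h : E → ℝ) (x : E) : ℝ :=
  fderiv ℝ h x (π x (fderiv ℝ f x))

/-- `π` is a Poisson tensor on the open set `U`: a smooth bivector field whose bracket satisfies
the Jacobi identity. -/
def IsPoissonOn (π : SharpField E) (U : Set E) : Prop :=
  IsBivectorFieldOn π U ∧
  ∀ f g h : E → ℝ, ContDiffOn ℝ ∞ f U → ContDiffOn ℝ ∞ g U → ContDiffOn ℝ ∞ h U → ∀ x ∈ U,
    bracket π f (bracket π g h) x + bracket π g (bracket π h f) x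
      + bracket π h (bracket π f g) x = 0

/-- `π' = F_* π` on `U`, for a linear automorphism `F` of `E` that preserves `U`. -/
def IsPushforwardOn (F : E →L[ℝ] E) (π π' : SharpField E) (U : Set E) : Prop :=
  ∀ x ∈ U, ∀ β : E →L[ℝ] ℝ, π' (F x) β = F (π x (β ∘L F))

/-- A connected (nonempty) integral manifold in `U` of the distribution `π♯(T*E)`. -/
structure IsConnectedIntegral (π : SharpField E) (U : Set E) (N : ImmersedSubmanifold E) :
    Prop where
  connected : ConnectedSpace N.M
  subset : N.toSet ⊆ U
  tangent : ∀ p : N.M, Set.range (N.dincl p) = Set.range (π (N.incl p))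

/-- A symplectic leaf of `π` on `U`: a maximal integral manifold of `π♯(T*E)`, i.e. a connected
integral manifold such that every connected integral manifold that meets it is contained in it
as a submanifold (the inclusion being smooth). -/
structure IsSymplecticLeaf (π : SharpField E) (U : Set E) (L : ImmersedSubmanifold E) :
    Prop where
  integral : IsConnectedIntegral π U L
  maximal : ∀ N : ImmersedSubmanifold E, IsConnectedIntegral π U N →
    (N.toSet ∩ L.toSet).Nonempty →
      ∃ j : N.M → L.M, ContMDiff (𝓡 N.dim) (𝓡 L.dim) ∞ j ∧ ∀ p, L.incl (j p) = N.incl p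

/-- `Ω` is the form induced by `π` on the integral manifold `L`, characterized by
`i_* ∘ (Ω♭)⁻¹ ∘ i^* = π♯`: whenever `i_* u = π♯ α` one has `Ω♭ u = i^* α`. -/
def IsInducedForm (π : SharpField E) (L : ImmersedSubmanifold E) (Ω : BilinField L.dim L.M) :
    Prop :=
  ∀ (p : L.M) (u : TangentSpace (𝓡 L.dim) p) (α : E →L[ℝ] ℝ),
    L.dincl p u = π (L.incl p) α → Ω p u = α ∘L L.dincl p

/-- `Ω = (Ω₁, Ω₂, Ω₃)` is the hypersymplectic structure induced on `L` by `(π₁, π₂, π₃)`. -/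
def IsInducedHypersymplectic (π : Fin 3 → SharpField E) (L : ImmersedSubmanifold E)
    (Ω : Fin 3 → BilinField L.dim L.M) : Prop :=
  (∀ i, IsInducedForm (π i) L (Ω i)) ∧ IsHypersymplectic Ω

end Poisson

/-! ### The space `𝔤 × 𝔤 × 𝔤` -/

/-- The space `𝔤³` of triples. It carries the componentwise vector space structure and the
canonical topology of a finite-dimensional real vector space, presented by a norm coming from
an arbitrary linear coordinate system. -/
def Triple (𝔤 : Type u) : Type u := Fin 3 → 𝔤

section Triples

variable {𝔤 : Type u} [LieRing 𝔤] [LieAlgebra ℝ 𝔤] [FiniteDimensional ℝ 𝔤]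

/-- Linear coordinates on triples. -/
noncomputable def tripleCoord (𝔤 : Type u) [LieRing 𝔤] [LieAlgebra ℝ 𝔤]
    [FiniteDimensional ℝ 𝔤] :
    (Fin 3 → 𝔤) ≃ₗ[ℝ] (Fin (Module.finrank ℝ (Fin 3 → 𝔤)) → ℝ) :=
  (Module.finBasis ℝ (Fin 3 → 𝔤)).equivFun

noncomputable instance : NormedAddCommGroup (Triple 𝔤) :=
  NormedAddCommGroup.induced (Fin 3 → 𝔤) (Fin (Module.finrank ℝ (Fin 3 → 𝔤)) → ℝ)
    (tripleCoord 𝔤) (tripleCoord 𝔤).injective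

noncomputable instance : NormedSpace ℝ (Triple 𝔤) :=
  NormedSpace.induced ℝ (Fin 3 → 𝔤) (Fin (Module.finrank ℝ (Fin 3 → 𝔤)) → ℝ) (tripleCoord 𝔤)

instance : FiniteDimensional ℝ (Triple 𝔤) :=
  inferInstanceAs (FiniteDimensional ℝ (Fin 3 → 𝔤))

/-- The linear map `σ_O (a₁, a₂, a₃) = (a₁, a₂, a₃) O`, i.e. `(σ_O a)ⱼ = ∑ᵢ Oᵢⱼ aᵢ`. -/
noncomputable def sigma (O : Matrix (Fin 3) (Fin 3) ℝ) : Triple 𝔤 →L[ℝ] Triple 𝔤 :=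
  LinearMap.toContinuousLinearMap
    { toFun := fun a => (fun j => ∑ i, O i j • a i : Fin 3 → 𝔤)
      map_add' := fun a b => funext fun j => by
        change ∑ i, O i j • (a i + b i) = ∑ i, O i j • a i + ∑ i, O i j • b i
        simp only [smul_add, Finset.sum_add_distrib]
      map_smul' := fun c a => funext fun j => by
        change ∑ i, O i j • (c • a i) = c • ∑ i, O i j • a i
        simp only [Finset.smul_sum, smul_comm c] }

/-- The cyclic permutation `(a₁, a₂, a₃) ↦ (a₃, a₁, a₂)`. -/
noncomputable def cyclic : Triple 𝔤 →L[ℝ] Triple 𝔤 :=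
  LinearMap.toContinuousLinearMap
    { toFun := fun a => (![a 2, a 0, a 1] : Fin 3 → 𝔤)
      map_add' := fun a b => funext fun j => by fin_cases j <;> rfl
      map_smul' := fun c a => funext fun j => by fin_cases j <;> rfl }

/-- The linear function `l^j_ξ (a₁, a₂, a₃) = ⟨ξ, aⱼ⟩`, with `⟨-,-⟩` the Killing form. -/
noncomputable def linFun (j : Fin 3) (ξ : 𝔤) : Triple 𝔤 →L[ℝ] ℝ :=
  LinearMap.toContinuousLinearMap
    { toFun := fun a => killingForm ℝ 𝔤 ξ (a j)
      map_add' := fun a b => map_add (killingForm ℝ 𝔤 ξ) (a j) (b j)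
      map_smul' := fun c a => map_smul (killingForm ℝ 𝔤 ξ) c (a j) }

/-- The contraction `ξ ⌟ T ⌟ ζ` of a tensor `T ∈ 𝔤 ⊗ 𝔤` by means of the Killing form:
`(x ⊗ y)_{ξ,ζ} = ⟨ξ, x⟩ ⟨ζ, y⟩`. -/
noncomputable def contract (T : 𝔤 ⊗[ℝ] 𝔤) (ξ ζ : 𝔤) : ℝ :=
  TensorProduct.lid ℝ ℝ (TensorProduct.map (killingForm ℝ 𝔤 ξ) (killingForm ℝ 𝔤 ζ) T)

/-- `(π₁, π₂, π₃)`, indexed by `0, 1, 2`, is the hyper-Lie Poisson structure on the open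
set `U` of triples that is determined by the function `A` with values in symmetric 2-tensors. -/
structure IsHyperLiePoisson (U : Set (Triple 𝔤)) (A : Triple 𝔤 → 𝔤 ⊗[ℝ] 𝔤)
    (π : Fin 3 → SharpField (Triple 𝔤)) : Prop where
  isOpen : IsOpen U
  sigma_mem : ∀ O ∈ Matrix.specialOrthogonalGroup (Fin 3) ℝ, ∀ a ∈ U, sigma O a ∈ U
  /- `A` is a smooth `SO(3)`-invariant function on `U` with values in `S²(𝔤)` -/
  symm : ∀ a ∈ U, TensorProduct.comm ℝ 𝔤 𝔤 (A a) = A a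
  smooth : ∀ ξ ζ : 𝔤, ContDiffOn ℝ ∞ (fun a => contract (A a) ξ ζ) U
  invariant : ∀ O ∈ Matrix.specialOrthogonalGroup (Fin 3) ℝ, ∀ a ∈ U, A (sigma O a) = A a
  /- the brackets that define `π₁` -/
  bracket₁₁ : ∀ a ∈ U, ∀ ξ ζ : 𝔤,
    bracket (π 0) (linFun 0 ξ) (linFun 0 ζ) a = linFun 0 ⁅ξ, ζ⁆ a
  bracket₁₂ : ∀ a ∈ U, ∀ ξ ζ : 𝔤,
    bracket (π 0) (linFun 0 ξ) (linFun 1 ζ) a = linFun 1 ⁅ξ, ζ⁆ a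
  bracket₂₁ : ∀ a ∈ U, ∀ ξ ζ : 𝔤,
    bracket (π 0) (linFun 1 ξ) (linFun 0 ζ) a = linFun 1 ⁅ξ, ζ⁆ a
  bracket₂₂ : ∀ a ∈ U, ∀ ξ ζ : 𝔤,
    bracket (π 0) (linFun 1 ξ) (linFun 1 ζ) a = -linFun 0 ⁅ξ, ζ⁆ a
  bracket₁₃ : ∀ a ∈ U, ∀ ξ ζ : 𝔤,
    bracket (π 0) (linFun 0 ξ) (linFun 2 ζ) a = linFun 2 ⁅ξ, ζ⁆ a
  bracket₃₁ : ∀ a ∈ U, ∀ ξ ζ : 𝔤,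
    bracket (π 0) (linFun 2 ξ) (linFun 0 ζ) a = linFun 2 ⁅ξ, ζ⁆ a
  bracket₃₃ : ∀ a ∈ U, ∀ ξ ζ : 𝔤,
    bracket (π 0) (linFun 2 ξ) (linFun 2 ζ) a = -linFun 0 ⁅ξ, ζ⁆ a
  bracket₂₃ : ∀ a ∈ U, ∀ ξ ζ : 𝔤,
    bracket (π 0) (linFun 1 ξ) (linFun 2 ζ) a = contract (A a) ξ ζ
  bracket₃₂ : ∀ a ∈ U, ∀ ξ ζ : 𝔤,
    bracket (π 0) (linFun 2 ξ) (linFun 1 ζ) a = -contract (A a) ξ ζ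
  /- `π₂ = σ_* π₁` and `π₃ = σ_* π₂` for the cyclic permutation `σ` -/
  push₁₂ : IsPushforwardOn cyclic (π 0) (π 1) U
  push₂₃ : IsPushforwardOn cyclic (π 1) (π 2) U
  poisson : IsPoissonOn (π 0) U
  /- the symplectic foliations coincide, i.e. the tangent distributions `πᵢ♯(T*)` agree -/
  foliation : ∀ a ∈ U, ∀ i j, Set.range (π i a) = Set.range (π j a)
  /- each symplectic leaf is hypersymplectic for the forms induced by `π₁, π₂, π₃` -/
  hypersymplectic : ∀ L : ImmersedSubmanifold (Triple 𝔤), IsSymplecticLeaf (π 0) U L →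
    ∃ Ω : Fin 3 → BilinField L.dim L.M, IsInducedHypersymplectic π L Ω

end Triples

end HyperLie

namespace HyperLie

universe u

/-! ### Linear algebra -/

/-! All brackets of the three bivector fields follow one formula (`linFun_sharp`): `{lⁱ_ξ, lʲ_ζ}_k =
δ_ik lʲ + δ_jk lⁱ - δ_ij lᵏ + ε_kij A_{ξ,ζ}`, with the functions `l` on the right taken at `⁅ξ, ζ⁆`.
Under `O(3)` the symbol `δ` is invariant and `ε` is multiplied by the determinant, a sign that
`A(aO) = det(O) A(a)` absorbs. As the `lʲ_ξ` span the dual space (the Killing form is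
nondegenerate), this gives `(σ_O)_* π_k = ∑ₘ O_km πₘ` (`sigma_sharp`). The three distributions
coincide, so `σ_O` preserves their common value and carries maximal integral manifolds to maximal
integral manifolds (`range_sigma`, `IsSymplecticLeaf.map`).

On a leaf the rotation must pass from the bivectors to the inverse forms, although inversion is not
linear. For a unit vector `c`, expand `(∑ c_l π_l♯)(∑ c_k ω_k♭)`: the diagonal terms add up to the
identity, and the terms `(l, k)` and `(k, l)` cancel because the hypersymplectic condition makes
`π_l♯ ω_k♭` skew in `l ≠ k`. So `∑ c_k ω_k` inverts `∑ c_l π_l`. Applied to the columns of `O`, this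
rotates the forms by `R = O` itself (`pullsBackTo_of_rotation`), and the sign of `det O` separates
the two cases. -/

/-- The Levi-Civita symbol on `Fin 3`. -/
noncomputable def leviCivita (i j k : Fin 3) : ℝ :=
  (((i : ℕ) : ℝ) - (j : ℕ)) * (((j : ℕ) : ℝ) - (k : ℕ)) * (((k : ℕ) : ℝ) - (i : ℕ)) / 2

/-- The cross product of two columns of `O` consists of cofactors. No orthogonality is needed, and
the 27 cases are polynomial identities. -/
lemma sum_leviCivita_mul_mul (O : Matrix (Fin 3) (Fin 3) ℝ) (k i j : Fin 3) :
    ∑ p, ∑ q, O p i * O q j * leviCivita k p q = ∑ m, O.adjugate m k * leviCivita m i j := by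
  rw [Matrix.adjugate_fin_three]
  fin_cases k <;> fin_cases i <;> fin_cases j <;>
    simp [Fin.sum_univ_three, leviCivita] <;> ring

lemma adjugate_apply_of_mem_orthogonalGroup {O : Matrix (Fin 3) (Fin 3) ℝ}
    (hO : O ∈ Matrix.orthogonalGroup (Fin 3) ℝ) (m k : Fin 3) :
    O.adjugate m k = O.det * O k m := by
  have h1 : O.transpose * O = 1 := (Matrix.mem_orthogonalGroup_iff' (Fin 3) ℝ).1 hO
  have h2 : O.adjugate = O.det • O.transpose := by
    calc O.adjugate = (O.transpose * O) * O.adjugate := by rw [h1, one_mul]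
      _ = O.det • O.transpose := by rw [mul_assoc, Matrix.mul_adjugate]; simp
  rw [h2]; simp

lemma transpose_mem_orthogonalGroup {O : Matrix (Fin 3) (Fin 3) ℝ}
    (hO : O ∈ Matrix.orthogonalGroup (Fin 3) ℝ) :
    O.transpose ∈ Matrix.orthogonalGroup (Fin 3) ℝ := by
  have h1 : O.transpose * O = 1 := (Matrix.mem_orthogonalGroup_iff' (Fin 3) ℝ).1 hO
  rw [Matrix.mem_orthogonalGroup_iff]
  simpa [Matrix.star_eq_conjTranspose] using h1

lemma sum_mul_col_eq {O : Matrix (Fin 3) (Fin 3) ℝ}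
    (hO : O ∈ Matrix.orthogonalGroup (Fin 3) ℝ) (i j : Fin 3) :
    ∑ p, O p i * O p j = if i = j then 1 else 0 := by
  have h1 : O.transpose * O = 1 := (Matrix.mem_orthogonalGroup_iff' (Fin 3) ℝ).1 hO
  simpa [Matrix.mul_apply, Matrix.one_apply] using congrFun (congrFun h1 i) j

lemma sum_mul_row_eq {O : Matrix (Fin 3) (Fin 3) ℝ}
    (hO : O ∈ Matrix.orthogonalGroup (Fin 3) ℝ) (i j : Fin 3) :
    ∑ p, O i p * O j p = if i = j then 1 else 0 := by
  have h1 : O * O.transpose = 1 := (Matrix.mem_orthogonalGroup_iff (Fin 3) ℝ).1 hO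
  simpa [Matrix.mul_apply, Matrix.one_apply] using congrFun (congrFun h1 i) j

/-- The common shape of the brackets `{lⁱ, lʲ}_k`, where `x i` stands for `lⁱ` and `α` for `A`. -/
noncomputable def bracketShape (x : Fin 3 → ℝ) (α : ℝ) (k i j : Fin 3) : ℝ :=
  (if i = k then x j else 0) + (if j = k then x i else 0) - (if i = j then x k else 0)
    + leviCivita k i j * α

/-- Equivariance of the brackets under an orthogonal matrix. -/
lemma sum_mul_bracketShape {O : Matrix (Fin 3) (Fin 3) ℝ}
    (hO : O ∈ Matrix.orthogonalGroup (Fin 3) ℝ) (x : Fin 3 → ℝ) (α : ℝ) (k i j : Fin 3) :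
    ∑ p, ∑ q, O p i * O q j * bracketShape x α k p q
      = ∑ m, O k m * bracketShape (fun n => ∑ q, O q n * x q) (O.det * α) m i j := by
  have e1 : ∑ p, ∑ q, O p i * O q j * (if p = k then x q else 0)
      = O k i * ∑ q, O q j * x q := by
    simp [Finset.mul_sum, mul_assoc]
  have e2 : ∑ p, ∑ q, O p i * O q j * (if q = k then x p else 0)
      = O k j * ∑ q, O q i * x q := by
    simp only [mul_ite, mul_zero, Finset.sum_ite_eq', Finset.mem_univ, if_true, Finset.mul_sum]
    exact Finset.sum_congr rfl fun p _ => by ring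
  have e3 : ∑ p, ∑ q, O p i * O q j * (if p = q then x k else 0)
      = (if i = j then 1 else 0) * x k := by
    rw [← sum_mul_col_eq hO, Finset.sum_mul]
    simp
  have e4 : ∑ p, ∑ q, O p i * O q j * (leviCivita k p q * α)
      = ∑ m, O k m * (leviCivita m i j * (O.det * α)) := by
    simp only [← mul_assoc, ← Finset.sum_mul, sum_leviCivita_mul_mul]
    simp only [adjugate_apply_of_mem_orthogonalGroup hO, Finset.sum_mul]
    exact Finset.sum_congr rfl fun p _ => by ring
  -- Orthogonality of the rows undoes the rotation of `x`; this matches the `δ_ij` terms on the two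
  -- sides.
  have f3 : ∑ m, O k m * (∑ q, O q m * x q) = x k := by
    simp only [Finset.mul_sum]
    rw [Finset.sum_comm]
    simp only [← mul_assoc, ← Finset.sum_mul, sum_mul_row_eq hO]
    simp
  have f3' : ∑ m, O k m * (if i = j then ∑ q, O q m * x q else 0)
      = (if i = j then 1 else 0) * x k := by
    split_ifs <;> simp [f3]
  simp only [bracketShape, mul_add, mul_sub, Finset.sum_add_distrib, Finset.sum_sub_distrib,
    e1, e2, e3, e4, f3']
  simp

/-- If `(S⁻¹ T)² = -1` then `S⁻¹ T = -T⁻¹ S`. -/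
lemma add_eq_zero_of_inverse_comp_sq {V : Type*} [AddCommGroup V] [TopologicalSpace V]
    [IsTopologicalAddGroup V] [Module ℝ V] [ContinuousSMul ℝ V]
    (S T : V →L[ℝ] V →L[ℝ] ℝ)
    (h : ∀ v, (S.inverse ∘L T) ((S.inverse ∘L T) v) = -v) {u w w' : V}
    (hw : S w = T u) (hw' : T w' = S u) : w + w' = 0 := by
  by_cases hS : S.IsInvertible
  · have hinv : ∀ v, S.inverse (S v) = v := fun v => by
      obtain ⟨e, rfl⟩ := hS
      simp
    have hinv' : ∀ v, S (S.inverse v) = v := fun v => by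
      obtain ⟨e, rfl⟩ := hS
      simp
    have h1 : S.inverse (T w) = -u := by
      have := h u
      simp only [ContinuousLinearMap.comp_apply, ← hw, hinv] at this
      exact this
    -- Applying `S` to `S⁻¹ T w = -u` gives `T w = -S u = -T w'`. Injectivity of `T` is not needed:
    -- the hypothesis at `w + w'` finishes.
    have h2 : T (w + w') = 0 := by
      rw [map_add, hw', ← hinv' (T w), h1, map_neg, neg_add_cancel]
    have h3 := h (w + w')
    simp only [ContinuousLinearMap.comp_apply, h2, map_zero] at h3
    exact neg_eq_zero.1 h3.symm
  -- For non-invertible `S` the value of `inverse` is `0` by default, so the hypothesis reads `0 =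
  -- -v` and the space is trivial.
  · have hz : ∀ v : V, v = 0 := fun v => by
      have := h v
      rw [ContinuousLinearMap.inverse_of_not_isInvertible hS] at this
      simpa using this.symm
    exact hz _

/-! ### Images of integral manifolds under linear automorphisms -/

section Map

variable {E : Type u} [NormedAddCommGroup E] [NormedSpace ℝ E]

lemma ImmersedSubmanifold.mdifferentiableAt_incl (N : ImmersedSubmanifold E) (p : N.M) :
    MDifferentiableAt (𝓡 N.dim) 𝓘(ℝ, E) N.incl p :=
  N.incl_smooth.mdifferentiableAt (by simp)

lemma ImmersedSubmanifold.mfderiv_clm_comp_incl (N : ImmersedSubmanifold E) (e : E →L[ℝ] E)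
    (p : N.M) :
    mfderiv (𝓡 N.dim) 𝓘(ℝ, E) (fun q => e (N.incl q)) p = e ∘L N.dincl p :=
  (e.hasMFDerivAt.comp p (N.mdifferentiableAt_incl p).hasMFDerivAt).mfderiv

/-- The image of an immersed submanifold under a linear automorphism. -/
def ImmersedSubmanifold.map (N : ImmersedSubmanifold E) (e : E ≃L[ℝ] E) :
    ImmersedSubmanifold E where
  dim := N.dim
  M := N.M
  incl := fun p => e (N.incl p)
  incl_injective := e.injective.comp N.incl_injective
  incl_smooth := e.contDiff.contMDiff.comp N.incl_smooth
  incl_immersion := fun p => by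
    have := N.mfderiv_clm_comp_incl (e : E →L[ℝ] E) p
    intro u v huv
    rw [show (fun p => e (N.incl p)) = fun q => (e : E →L[ℝ] E) (N.incl q) from rfl, this] at huv
    exact N.incl_immersion p (e.injective huv)

lemma ImmersedSubmanifold.dincl_map (N : ImmersedSubmanifold E) (e : E ≃L[ℝ] E) (p : N.M)
    (u : TangentSpace (𝓡 N.dim) p) : (N.map e).dincl p u = e (N.dincl p u) :=
  congrArg (fun f : TangentSpace (𝓡 N.dim) p →L[ℝ] E => f u)
    (N.mfderiv_clm_comp_incl (e : E →L[ℝ] E) p)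

lemma ImmersedSubmanifold.toSet_map (N : ImmersedSubmanifold E) (e : E ≃L[ℝ] E) :
    (N.map e).toSet = e '' N.toSet :=
  Set.range_comp e N.incl

variable {π : SharpField E} {U : Set E}

lemma IsConnectedIntegral.map {N : ImmersedSubmanifold E} (hN : IsConnectedIntegral π U N)
    (e : E ≃L[ℝ] E) (hU : ∀ a ∈ U, e a ∈ U)
    (hr : ∀ a ∈ U, Set.range (π (e a)) = e '' Set.range (π a)) :
    IsConnectedIntegral π U (N.map e) where
  connected := hN.connected
  subset := by
    rw [N.toSet_map]
    rintro _ ⟨a, ha, rfl⟩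
    exact hU a (hN.subset ha)
  tangent := fun p => by
    have h1 : Set.range ((N.map e).dincl p) = e '' Set.range (N.dincl p) := by
      rw [← Set.range_comp]
      exact congrArg Set.range (funext fun u => N.dincl_map e p u)
    rw [h1, hN.tangent p]
    exact (hr _ (hN.subset ⟨p, rfl⟩)).symm

/-- A competing integral manifold is moved back by `e⁻¹` and absorbed by `L`. The resulting map `j`
also serves for the image, since `map` changes the inclusion but not the underlying manifold. -/
lemma IsSymplecticLeaf.map {L : ImmersedSubmanifold E} (hL : IsSymplecticLeaf π U L)
    (e : E ≃L[ℝ] E) (hU : ∀ a ∈ U, e a ∈ U) (hU' : ∀ a ∈ U, e.symm a ∈ U)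
    (hr : ∀ a ∈ U, Set.range (π (e a)) = e '' Set.range (π a))
    (hr' : ∀ a ∈ U, Set.range (π (e.symm a)) = e.symm '' Set.range (π a)) :
    IsSymplecticLeaf π U (L.map e) where
  integral := hL.integral.map e hU hr
  maximal := fun N hN ⟨x, ⟨p, hp⟩, ⟨q, hq⟩⟩ => by
    obtain ⟨j, hj, hj'⟩ := hL.maximal (N.map e.symm) (hN.map e.symm hU' hr')
      ⟨e.symm x, ⟨p, congrArg e.symm hp⟩, ⟨q, by rw [← hq]; exact (e.symm_apply_apply _).symm⟩⟩
    refine ⟨j, hj, fun p => ?_⟩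
    exact (congrArg e (hj' p)).trans (e.apply_symm_apply _)

/-- Symplectic leaves with the same underlying set are diffeomorphic over the ambient space. -/
lemma IsSymplecticLeaf.exists_diffeomorph {L L' : ImmersedSubmanifold E}
    (hL : IsSymplecticLeaf π U L) (hL' : IsSymplecticLeaf π U L') (h : L'.toSet = L.toSet) :
    ∃ F : L.M ≃ₘ⟮𝓡 L.dim, 𝓡 L'.dim⟯ L'.M, ∀ p, L'.incl (F p) = L.incl p := by
  have hne : L.toSet.Nonempty :=
    let ⟨p⟩ := hL.integral.connected.toNonempty
    ⟨L.incl p, p, rfl⟩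
  -- Each leaf absorbs the other by maximality; injectivity of the inclusions makes the two smooth
  -- maps mutually inverse.
  obtain ⟨j, hj, hj'⟩ := hL'.maximal L hL.integral (by rwa [h, Set.inter_self])
  obtain ⟨k, hk, hk'⟩ := hL.maximal L' hL'.integral (by rwa [h, Set.inter_self])
  exact ⟨{ toFun := j
           invFun := k
           left_inv := fun p => L.incl_injective (by rw [hk', hj'])
           right_inv := fun p => L'.incl_injective (by rw [hj', hk'])
           contMDiff_toFun := hj
           contMDiff_invFun := hk }, hj'⟩

/-- Chain rule for a smooth map over a linear map of the ambient space. -/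
lemma ImmersedSubmanifold.dincl_mfderiv {L L' : ImmersedSubmanifold E} (e : E →L[ℝ] E)
    (F : L.M ≃ₘ⟮𝓡 L.dim, 𝓡 L'.dim⟯ L'.M) (hF : ∀ p, L'.incl (F p) = e (L.incl p)) (p : L.M)
    (u : TangentSpace (𝓡 L.dim) p) :
    L'.dincl (F p) (mfderiv (𝓡 L.dim) (𝓡 L'.dim) F p u) = e (L.dincl p u) := by
  have h1 : mfderiv (𝓡 L.dim) 𝓘(ℝ, E) (fun q => L'.incl (F q)) p
      = (L'.dincl (F p)) ∘L (mfderiv (𝓡 L.dim) (𝓡 L'.dim) F p) :=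
    ((L'.mdifferentiableAt_incl (F p)).hasMFDerivAt.comp p
      (F.mdifferentiable (by simp) p).hasMFDerivAt).mfderiv
  have h2 : mfderiv (𝓡 L.dim) 𝓘(ℝ, E) (fun q => L'.incl (F q)) p = e ∘L L.dincl p := by
    rw [funext hF]
    exact L.mfderiv_clm_comp_incl e p
  exact congrArg (fun f : TangentSpace (𝓡 L.dim) p →L[ℝ] E => f u) (h1.symm.trans h2)

/-- A diffeomorphism of leaves over a linear automorphism that rotates a triple of bivector fields
rotates the induced hypersymplectic structures in the same way. -/
lemma pullsBackTo_of_rotation {π : Fin 3 → SharpField E} {L L' : ImmersedSubmanifold E}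
    {Ω : Fin 3 → BilinField L.dim L.M} {Ω' : Fin 3 → BilinField L'.dim L'.M}
    (hΩ : IsInducedHypersymplectic π L Ω) (hΩ' : IsInducedHypersymplectic π L' Ω')
    (hr : ∀ p i, Set.range (L.dincl p) = Set.range (π i (L.incl p)))
    (e : E ≃L[ℝ] E) (F : L.M ≃ₘ⟮𝓡 L.dim, 𝓡 L'.dim⟯ L'.M)
    (hF : ∀ p, L'.incl (F p) = e (L.incl p)) {O : Matrix (Fin 3) (Fin 3) ℝ}
    (hO : O ∈ Matrix.orthogonalGroup (Fin 3) ℝ)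
    (hπ : ∀ p k (β : E →L[ℝ] ℝ), e (π k (L.incl p) (β ∘L (e : E →L[ℝ] E)))
      = ∑ m, O k m • π m (e (L.incl p)) β) :
    PullsBackTo F Ω Ω' O := by
  intro m p u v
  have hF' := L.dincl_mfderiv (L' := L') (e : E →L[ℝ] E) F hF p
  have hα : ∀ k, ∃ α : E →L[ℝ] ℝ, π k (L.incl p) α = L.dincl p u := fun k => by
    have : L.dincl p u ∈ Set.range (π k (L.incl p)) := hr p k ▸ ⟨u, rfl⟩
    exact this
  choose α hα using hα
  -- The common range lets `π_l♯ α_k` be lifted to a tangent vector `w l k` of the leaf, which is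
  -- `(Ω_l♭)⁻¹ Ω_k♭ u`.
  have hw : ∀ l k, ∃ w, L.dincl p w = π l (L.incl p) (α k) := fun l k => by
    have : π l (L.incl p) (α k) ∈ Set.range (L.dincl p) := hr p l ▸ ⟨α k, rfl⟩
    exact this
  choose w hw using hw
  have hΩu : ∀ k, Ω k p u = α k ∘L L.dincl p := fun k => hΩ.1 k p u (α k) (hα k).symm
  have hΩw : ∀ l k, Ω l p (w l k) = Ω k p u := fun l k =>
    (hΩ.1 l p (w l k) (α k) (hw l k)).trans (hΩu k).symm
  have hskew : ∀ l k, l ≠ k → π k (L.incl p) (α l) = -π l (L.incl p) (α k) := fun l k hlk => by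
    have h0 := add_eq_zero_of_inverse_comp_sq (V := TangentSpace (𝓡 L.dim) p)
      (Ω l p) (Ω k p) (hΩ.2.sq_eq_neg_id l k hlk p) (hΩw l k) (hΩw k l)
    have h1 : L.dincl p (w l k) + L.dincl p (w k l) = 0 := by rw [← map_add, h0, map_zero]
    rw [hw, hw, add_comm] at h1
    exact eq_neg_of_add_eq_zero_left h1
  have hrow : ∑ k, O k m * O k m = 1 := by simpa using sum_mul_col_eq hO m m
  set γ : E →L[ℝ] ℝ := ∑ k, O k m • α k with hγ
  have hdiag : ∑ l, O l m • π l (L.incl p) γ = L.dincl p u := by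
    have : L.dincl p u = (∑ k, O k m * O k m) • L.dincl p u := by rw [hrow, one_smul]
    rw [this, hγ]
    simp only [Fin.sum_univ_three, map_add, map_smul, hα]
    -- The off-diagonal terms carry the symmetric weights `O l m * O k m` and cancel in pairs.
    rw [hskew 0 1 (by decide), hskew 0 2 (by decide), hskew 1 2 (by decide)]
    module
  -- The covector at the image point that represents `e (L.dincl p u)` through `π m`; its pullback
  -- to `L` is `∑ O_km Ω_k(u, ·)`.
  set β : E →L[ℝ] ℝ := γ ∘L (e.symm : E →L[ℝ] E) with hβ
  have hβe : β ∘L (e : E →L[ℝ] E) = γ := by ext; simp [hβ]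
  have hπ' : π m (e (L.incl p)) β = e (L.dincl p u) := by
    rw [← hdiag, map_sum]
    simp only [map_smul]
    calc π m (e (L.incl p)) β
        = ∑ n, (if m = n then (1 : ℝ) else 0) • π n (e (L.incl p)) β := by simp
      _ = ∑ n, (∑ l, O l m * O l n) • π n (e (L.incl p)) β := by simp only [sum_mul_col_eq hO]
      _ = ∑ l, O l m • e (π l (L.incl p) (β ∘L (e : E →L[ℝ] E))) := by
        simp only [hπ, Finset.smul_sum, Finset.sum_smul, smul_smul]
        exact Finset.sum_comm
      _ = _ := by rw [hβe]
  have h1 := hΩ'.1 m (F p) (mfderiv (𝓡 L.dim) (𝓡 L'.dim) F p u) β (by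
    rw [hF', hF, hπ']; rfl)
  rw [h1]
  change β (L'.dincl (F p) (mfderiv (𝓡 L.dim) (𝓡 L'.dim) F p v)) = _
  rw [hF' v]
  simp only [hΩu, hβ, hγ]
  simp [mul_comm]

end Map

/-! ### The action of `O(3)` on triples -/

section Triples

variable {𝔤 : Type u} [LieRing 𝔤] [LieAlgebra ℝ 𝔤]

lemma contract_neg (T : 𝔤 ⊗[ℝ] 𝔤) (ξ ζ : 𝔤) : contract (-T) ξ ζ = -contract T ξ ζ := by
  simp [contract]

variable [FiniteDimensional ℝ 𝔤]

lemma sigma_apply (O : Matrix (Fin 3) (Fin 3) ℝ) (a : Triple 𝔤) (j : Fin 3) :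
    sigma O a j = ∑ i, O i j • a i := rfl

lemma cyclic_apply (a : Triple 𝔤) : (cyclic a : Triple 𝔤) = (![a 2, a 0, a 1] : Fin 3 → 𝔤) := rfl

lemma linFun_apply (j : Fin 3) (ξ : 𝔤) (a : Triple 𝔤) :
    linFun j ξ a = killingForm ℝ 𝔤 ξ (a j) := rfl

lemma sigma_sigma (O O' : Matrix (Fin 3) (Fin 3) ℝ) (a : Triple 𝔤) :
    sigma O' (sigma O a) = sigma (O * O') a := by
  refine funext fun j => ?_
  simp only [sigma_apply, Finset.smul_sum, smul_smul, Matrix.mul_apply, Finset.sum_smul]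
  rw [Finset.sum_comm]
  simp only [mul_comm]

lemma sigma_one (a : Triple 𝔤) : sigma 1 a = a := by
  refine funext fun j => ?_
  rw [sigma_apply, Finset.sum_eq_single j] <;> simp +contextual

lemma sigma_neg_neg (O : Matrix (Fin 3) (Fin 3) ℝ) (a : Triple 𝔤) :
    sigma (-O) (-a) = sigma O a := by
  refine funext fun j => ?_
  rw [map_neg]
  change -sigma (-O) a j = _
  simp [sigma_apply]

/-- `σ_O` as an automorphism, for orthogonal `O`. -/
noncomputable def sigmaEquiv {O : Matrix (Fin 3) (Fin 3) ℝ}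
    (hO : O ∈ Matrix.orthogonalGroup (Fin 3) ℝ) : Triple 𝔤 ≃L[ℝ] Triple 𝔤 :=
  ContinuousLinearEquiv.equivOfInverse (sigma O) (sigma O.transpose)
    (fun a => by rw [sigma_sigma, show O * O.transpose = 1 from
      (Matrix.mem_orthogonalGroup_iff (Fin 3) ℝ).1 hO, sigma_one])
    (fun a => by rw [sigma_sigma, show O.transpose * O = 1 from
      (Matrix.mem_orthogonalGroup_iff' (Fin 3) ℝ).1 hO, sigma_one])

/-- The permutation matrix of the cyclic permutation. -/
def cyclicMatrix : Matrix (Fin 3) (Fin 3) ℝ := !![0, 1, 0; 0, 0, 1; 1, 0, 0]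

lemma cyclicMatrix_mem : cyclicMatrix ∈ Matrix.specialOrthogonalGroup (Fin 3) ℝ := by
  rw [Matrix.mem_specialOrthogonalGroup_iff, Matrix.mem_orthogonalGroup_iff]
  constructor
  · ext i j
    fin_cases i <;> fin_cases j <;>
      simp [cyclicMatrix, Matrix.mul_apply, Fin.sum_univ_three]
  · simp [cyclicMatrix, Matrix.det_fin_three]

lemma cyclic_eq_sigma (a : Triple 𝔤) : cyclic a = sigma cyclicMatrix a := by
  refine funext fun j => ?_
  rw [sigma_apply, cyclic_apply]
  fin_cases j <;> simp [cyclicMatrix, Fin.sum_univ_three]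

lemma linFun_comp_cyclic (j : Fin 3) (ξ : 𝔤) : (linFun j ξ).comp cyclic = linFun (j - 1) ξ := by
  ext a
  rw [ContinuousLinearMap.comp_apply, linFun_apply, linFun_apply, cyclic_apply]
  fin_cases j <;> rfl

lemma linFun_cyclic (j : Fin 3) (ξ : 𝔤) (a : Triple 𝔤) :
    linFun j ξ (cyclic a) = linFun (j - 1) ξ a :=
  congrArg (fun f : Triple 𝔤 →L[ℝ] ℝ => f a) (linFun_comp_cyclic j ξ)

lemma linFun_sigma (O : Matrix (Fin 3) (Fin 3) ℝ) (j : Fin 3) (ξ : 𝔤) (a : Triple 𝔤) :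
    linFun j ξ (sigma O a) = ∑ i, O i j * linFun i ξ a := by
  simp [linFun_apply, sigma_apply]

lemma linFun_comp_sigma (O : Matrix (Fin 3) (Fin 3) ℝ) (j : Fin 3) (ξ : 𝔤) :
    (linFun j ξ).comp (sigma O) = ∑ i, O i j • linFun i ξ := by
  ext a
  simp [linFun_sigma]

section Killing

variable [LieAlgebra.IsKilling ℝ 𝔤]

/-- Nondegeneracy of the Killing form, in each component. -/
lemma ext_linFun {a b : Triple 𝔤} (h : ∀ j ξ, linFun j ξ a = linFun j ξ b) : a = b := by
  refine funext fun j => ?_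
  have hs := (LieAlgebra.IsKilling.killingForm_nondegenerate ℝ 𝔤).2
  rw [← sub_eq_zero]
  refine hs _ fun ξ => ?_
  rw [map_sub, sub_eq_zero]
  exact h j ξ

/-- The functions `l^j_ξ` span the dual of the space of triples. -/
lemma exists_eq_sum_linFun (β : Triple 𝔤 →L[ℝ] ℝ) : ∃ ξ : Fin 3 → 𝔤, β = ∑ j, linFun j (ξ j) := by
  let s (j : Fin 3) : 𝔤 →ₗ[ℝ] Triple 𝔤 := LinearMap.single ℝ (fun _ : Fin 3 => 𝔤) j
  have h : ∀ j, ∃ ξ : 𝔤, ∀ x, killingForm ℝ 𝔤 ξ x = β (s j x) := fun j =>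
    ⟨((killingForm ℝ 𝔤).toDual (LieAlgebra.IsKilling.killingForm_nondegenerate ℝ 𝔤)).symm
      ((β : Triple 𝔤 →ₗ[ℝ] ℝ) ∘ₗ s j), fun x => by
        rw [LinearMap.BilinForm.apply_toDual_symm_apply]; rfl⟩
  choose ξ hξ using h
  refine ⟨ξ, ContinuousLinearMap.ext fun a => ?_⟩
  have h1 : a = ∑ j, s j (a j) :=
    (Finset.univ_sum_single (M := fun _ : Fin 3 => 𝔤) a).symm
  rw [sum_apply]
  simp only [linFun_apply, hξ]
  rw [← map_sum, ← h1]

end Killing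

/-! ### The bivector fields of a hyper-Lie Poisson structure -/

lemma bracket_linFun (π : SharpField (Triple 𝔤)) (i j : Fin 3) (ξ ζ : 𝔤) (a : Triple 𝔤) :
    bracket π (linFun i ξ) (linFun j ζ) a = linFun j ζ (π a (linFun i ξ)) := by
  rw [bracket, ContinuousLinearMap.fderiv, ContinuousLinearMap.fderiv]

namespace IsHyperLiePoisson

variable {U : Set (Triple 𝔤)} {A : Triple 𝔤 → 𝔤 ⊗[ℝ] 𝔤} {π : Fin 3 → SharpField (Triple 𝔤)}

lemma linFun_zero_apply (h : IsHyperLiePoisson U A π) {a : Triple 𝔤} (ha : a ∈ U) (i j : Fin 3)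
    (ξ ζ : 𝔤) : linFun j ζ (π 0 a (linFun i ξ))
      = bracketShape (fun n => linFun n ⁅ξ, ζ⁆ a) (contract (A a) ξ ζ) 0 i j := by
  rw [← bracket_linFun]
  fin_cases i <;> fin_cases j <;> simp [bracketShape, leviCivita]
  · exact h.bracket₁₁ a ha ξ ζ
  · exact h.bracket₁₂ a ha ξ ζ
  · exact h.bracket₁₃ a ha ξ ζ
  · exact h.bracket₂₁ a ha ξ ζ
  · exact h.bracket₂₂ a ha ξ ζ
  · exact (h.bracket₂₃ a ha ξ ζ).trans (by ring)
  · exact h.bracket₃₁ a ha ξ ζ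
  · exact (h.bracket₃₂ a ha ξ ζ).trans (by ring)
  · exact h.bracket₃₃ a ha ξ ζ

/-- Indices are taken modulo 3, and `ε` is invariant under a simultaneous cyclic shift. This
propagates the bracket formula from `π k` to its cyclic pushforward. -/
lemma bracketShape_sub_one (x : Fin 3 → ℝ) (α : ℝ) (k i j : Fin 3) :
    bracketShape (fun n => x (n - 1)) α k i j = bracketShape x α (k - 1) (i - 1) (j - 1) := by
  have hε : leviCivita k i j = leviCivita (k - 1) (i - 1) (j - 1) := by
    fin_cases k <;> fin_cases i <;> fin_cases j <;>
      simp [leviCivita, show (-1 : Fin 3) = 2 from rfl, show (2 - 1 : Fin 3) = 1 from rfl]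
      <;> norm_num
  simp only [bracketShape, hε, sub_left_inj]

lemma linFun_apply_of_push (h : IsHyperLiePoisson U A π) {k : Fin 3}
    (hk : IsPushforwardOn cyclic (π (k - 1)) (π k) U)
    (hf : ∀ a ∈ U, ∀ i j ξ ζ, linFun j ζ (π (k - 1) a (linFun i ξ))
      = bracketShape (fun n => linFun n ⁅ξ, ζ⁆ a) (contract (A a) ξ ζ) (k - 1) i j)
    {a : Triple 𝔤} (ha : a ∈ U) (i j : Fin 3) (ξ ζ : 𝔤) :
    linFun j ζ (π k a (linFun i ξ))
      = bracketShape (fun n => linFun n ⁅ξ, ζ⁆ a) (contract (A a) ξ ζ) k i j := by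
  have hc := cyclicMatrix_mem
  have hct : cyclicMatrix.transpose ∈ Matrix.specialOrthogonalGroup (Fin 3) ℝ := by
    rw [Matrix.mem_specialOrthogonalGroup_iff, Matrix.mem_orthogonalGroup_iff] at hc ⊢
    refine ⟨?_, by rw [Matrix.det_transpose]; exact hc.2⟩
    have := mul_eq_one_comm.1 hc.1
    simpa [Matrix.star_eq_conjTranspose] using this
  -- Pushforward is only known at points `cyclic b`; the inverse rotation, which also preserves `U`,
  -- supplies `b`.
  obtain ⟨b, hb, rfl⟩ : ∃ b ∈ U, cyclic b = a := by
    refine ⟨sigma cyclicMatrix.transpose a, h.sigma_mem _ hct a ha, ?_⟩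
    rw [cyclic_eq_sigma, sigma_sigma, show cyclicMatrix.transpose * cyclicMatrix = 1 from
      (Matrix.mem_orthogonalGroup_iff' (Fin 3) ℝ).1 hc.1, sigma_one]
  have hA : A (cyclic b) = A b := by rw [cyclic_eq_sigma]; exact h.invariant _ hc b hb
  rw [hk b hb, linFun_comp_cyclic, linFun_cyclic, hf b hb, hA]
  simp only [linFun_cyclic]
  exact (bracketShape_sub_one (fun n => linFun n ⁅ξ, ζ⁆ b) _ k i j).symm

lemma linFun_sharp (h : IsHyperLiePoisson U A π) (k : Fin 3) :
    ∀ a ∈ U, ∀ i j ξ ζ, linFun j ζ (π k a (linFun i ξ))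
      = bracketShape (fun n => linFun n ⁅ξ, ζ⁆ a) (contract (A a) ξ ζ) k i j := by
  have h0 := fun a (ha : a ∈ U) i j ξ ζ => h.linFun_zero_apply ha i j ξ ζ
  have h1 := fun a (ha : a ∈ U) i j ξ ζ =>
    h.linFun_apply_of_push (k := 1) h.push₁₂ h0 ha i j ξ ζ
  have h2 := fun a (ha : a ∈ U) i j ξ ζ =>
    h.linFun_apply_of_push (k := 2) h.push₂₃ h1 ha i j ξ ζ
  fin_cases k
  exacts [h0, h1, h2]

variable {O : Matrix (Fin 3) (Fin 3) ℝ}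

/-- In dimension 3, `-1` has determinant `-1`. An improper `O` is therefore handled by `σ_O(a) =
σ_{-O}(-a)` with `-O` in `SO(3)`, and oddness of `A` produces the sign. -/
lemma sigma_mem_and_contract (h : IsHyperLiePoisson U A π)
    (hO : O ∈ Matrix.orthogonalGroup (Fin 3) ℝ)
    (hneg : O.det = -1 → ∀ a ∈ U, -a ∈ U ∧ A (-a) = -A a) {a : Triple 𝔤} (ha : a ∈ U) :
    sigma O a ∈ U ∧ ∀ ξ ζ, contract (A (sigma O a)) ξ ζ = O.det * contract (A a) ξ ζ := by
  have hdet : O.det = 1 ∨ O.det = -1 := by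
    have h1 := congrArg Matrix.det ((Matrix.mem_orthogonalGroup_iff (Fin 3) ℝ).1 hO)
    rw [Matrix.det_mul, Matrix.det_transpose, Matrix.det_one] at h1
    exact mul_self_eq_one_iff.1 h1
  rcases hdet with hd | hd
  · have hS : O ∈ Matrix.specialOrthogonalGroup (Fin 3) ℝ :=
      Matrix.mem_specialOrthogonalGroup_iff.2 ⟨hO, hd⟩
    exact ⟨h.sigma_mem O hS a ha, fun ξ ζ => by rw [h.invariant O hS a ha, hd, one_mul]⟩
  · have hS : -O ∈ Matrix.specialOrthogonalGroup (Fin 3) ℝ := by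
      rw [Matrix.mem_specialOrthogonalGroup_iff, Matrix.mem_orthogonalGroup_iff] at *
      refine ⟨by simpa using hO, ?_⟩
      rw [Matrix.det_neg, hd]
      norm_num
    obtain ⟨hn, hA⟩ := hneg hd a ha
    rw [← sigma_neg_neg]
    exact ⟨h.sigma_mem _ hS _ hn, fun ξ ζ => by
      rw [h.invariant _ hS _ hn, hA, hd, contract_neg, neg_one_mul]⟩

variable [LieAlgebra.IsKilling ℝ 𝔤]

/-- `(σ_O)_* π_k = ∑ₘ O_{km} πₘ`. -/
lemma sigma_sharp (h : IsHyperLiePoisson U A π) (hO : O ∈ Matrix.orthogonalGroup (Fin 3) ℝ)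
    (hneg : O.det = -1 → ∀ a ∈ U, -a ∈ U ∧ A (-a) = -A a) {a : Triple 𝔤} (ha : a ∈ U)
    (k : Fin 3) (β : Triple 𝔤 →L[ℝ] ℝ) :
    sigma O (π k a (β ∘L sigma O)) = ∑ m, O k m • π m (sigma O a) β := by
  obtain ⟨hU, hA⟩ := h.sigma_mem_and_contract hO hneg ha
  obtain ⟨η, rfl⟩ := exists_eq_sum_linFun β
  have key : ∀ i ξ, sigma O (π k a ((linFun i ξ) ∘L sigma O))
      = ∑ m, O k m • π m (sigma O a) (linFun i ξ) := fun i ξ => ext_linFun fun j ζ => by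
    have hs := sum_mul_bracketShape hO (fun n => linFun n ⁅ξ, ζ⁆ a) (contract (A a) ξ ζ) k i j
    rw [linFun_comp_sigma, linFun_sigma, map_sum, map_sum]
    simp only [map_smul, map_sum, smul_eq_mul, h.linFun_sharp _ a ha, h.linFun_sharp _ _ hU, hA,
      linFun_sigma]
    rw [← hs, Finset.sum_comm]
    refine Finset.sum_congr rfl fun q _ => ?_
    rw [Finset.mul_sum]
    exact Finset.sum_congr rfl fun p _ => by ring
  have hcomp : (∑ j, linFun j (η j)) ∘L sigma O = ∑ j, (linFun j (η j)) ∘L sigma O := by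
    ext; simp
  rw [hcomp, map_sum, map_sum]
  simp only [key, map_sum, Finset.smul_sum]
  exact Finset.sum_comm

/-- By `sigma_sharp`, the image of a vector in the distribution is a combination of values of the
`πₘ`, all of which have the same range as `π 0`. -/
lemma image_range_subset (h : IsHyperLiePoisson U A π)
    (hO : O ∈ Matrix.orthogonalGroup (Fin 3) ℝ)
    (hneg : O.det = -1 → ∀ a ∈ U, -a ∈ U ∧ A (-a) = -A a) {a : Triple 𝔤} (ha : a ∈ U) :
    sigma O '' Set.range (π 0 a) ⊆ Set.range (π 0 (sigma O a)) := by
  rintro _ ⟨_, ⟨γ, rfl⟩, rfl⟩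
  have hU := (h.sigma_mem_and_contract hO hneg ha).1
  have hγ : γ = (γ ∘L sigma O.transpose) ∘L sigma O := by
    ext x
    simp only [ContinuousLinearMap.comp_apply, sigma_sigma]
    rw [show O * O.transpose = 1 from (Matrix.mem_orthogonalGroup_iff (Fin 3) ℝ).1 hO, sigma_one]
  rw [hγ, h.sigma_sharp hO hneg ha]
  have hm : ∀ m, π m (sigma O a) (γ ∘L sigma O.transpose)
      ∈ (π 0 (sigma O a)).range := fun m => by
    have : π m (sigma O a) (γ ∘L sigma O.transpose) ∈ Set.range (π 0 (sigma O a)) :=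
      h.foliation _ hU m 0 ▸ ⟨_, rfl⟩
    exact this
  exact Submodule.sum_mem _ fun m _ => Submodule.smul_mem _ _ (hm m)

/-- The reverse inclusion is `image_range_subset` for the inverse `Oᵀ` at the point `σ_O(a)`. -/
lemma range_sigma (h : IsHyperLiePoisson U A π) (hO : O ∈ Matrix.orthogonalGroup (Fin 3) ℝ)
    (hneg : O.det = -1 → ∀ a ∈ U, -a ∈ U ∧ A (-a) = -A a) {a : Triple 𝔤} (ha : a ∈ U) :
    Set.range (π 0 (sigma O a)) = sigma O '' Set.range (π 0 a) := by
  refine Set.Subset.antisymm ?_ (h.image_range_subset hO hneg ha)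
  intro x hx
  have hU := (h.sigma_mem_and_contract hO hneg ha).1
  have hsub := h.image_range_subset (transpose_mem_orthogonalGroup hO)
    (by rwa [Matrix.det_transpose]) hU
  rw [sigma_sigma, show O * O.transpose = 1 from
    (Matrix.mem_orthogonalGroup_iff (Fin 3) ℝ).1 hO, sigma_one] at hsub
  refine ⟨sigma O.transpose x, hsub ⟨x, hx, rfl⟩, ?_⟩
  rw [sigma_sigma, show O.transpose * O = 1 from
    (Matrix.mem_orthogonalGroup_iff' (Fin 3) ℝ).1 hO, sigma_one]

end IsHyperLiePoisson
end Triples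

end HyperLie

theorem theorem2p4 {𝔤 : Type*} [LieRing 𝔤] [LieAlgebra ℝ 𝔤] [FiniteDimensional ℝ 𝔤]
    [LieAlgebra.IsSemisimple ℝ 𝔤]
    (U : Set (HyperLie.Triple 𝔤)) (A : HyperLie.Triple 𝔤 → 𝔤 ⊗[ℝ] 𝔤)
    (π : Fin 3 → HyperLie.SharpField (HyperLie.Triple 𝔤))
    (h : HyperLie.IsHyperLiePoisson U A π)
    (O : Matrix (Fin 3) (Fin 3) ℝ) (hO : O ∈ Matrix.orthogonalGroup (Fin 3) ℝ)
    (hneg : O.det = -1 → ∀ a ∈ U, -a ∈ U ∧ A (-a) = -A a)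
    (L : HyperLie.ImmersedSubmanifold (HyperLie.Triple 𝔤))
    (hL : HyperLie.IsSymplecticLeaf (π 0) U L) :
    (∃ L' : HyperLie.ImmersedSubmanifold (HyperLie.Triple 𝔤),
      HyperLie.IsSymplecticLeaf (π 0) U L' ∧ L'.toSet = HyperLie.sigma O '' L.toSet) ∧
    ∀ L' : HyperLie.ImmersedSubmanifold (HyperLie.Triple 𝔤),
      HyperLie.IsSymplecticLeaf (π 0) U L' → L'.toSet = HyperLie.sigma O '' L.toSet →
      ∃ F : L.M ≃ₘ⟮𝓡 L.dim, 𝓡 L'.dim⟯ L'.M,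
        (∀ p : L.M, L'.incl (F p) = HyperLie.sigma O (L.incl p)) ∧
        ∃ (Ω : Fin 3 → HyperLie.BilinField L.dim L.M)
          (Ω' : Fin 3 → HyperLie.BilinField L'.dim L'.M),
          HyperLie.IsInducedHypersymplectic π L Ω ∧
          HyperLie.IsInducedHypersymplectic π L' Ω' ∧
          (O.det = 1 → HyperLie.IsHypersymplecticIso F Ω Ω') ∧
          (O.det = -1 → HyperLie.IsHypersymplecticAntiIso F Ω Ω') := by
  -- The inverse of `sigmaEquiv hO` is `σ` of the transpose, so the conditions on the inverse are
  -- the same lemmas for `Oᵀ`.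
  have hOt := HyperLie.transpose_mem_orthogonalGroup hO
  have hnegt : O.transpose.det = -1 → ∀ a ∈ U, -a ∈ U ∧ A (-a) = -A a := by
    rwa [Matrix.det_transpose]
  have hmap : HyperLie.IsSymplecticLeaf (π 0) U (L.map (HyperLie.sigmaEquiv hO)) :=
    hL.map (HyperLie.sigmaEquiv hO)
      (fun a ha => (h.sigma_mem_and_contract hO hneg ha).1)
      (fun a ha => (h.sigma_mem_and_contract hOt hnegt ha).1)
      (fun a ha => h.range_sigma hO hneg ha)
      (fun a ha => h.range_sigma hOt hnegt ha)
  refine ⟨⟨_, hmap, L.toSet_map (HyperLie.sigmaEquiv hO)⟩, fun L' hL' hset => ?_⟩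
  -- The image leaf `L.map` has the same underlying manifold as `L`, so a diffeomorphism from it to
  -- `L'` over the identity is one from `L` to `L'` over `σ_O`.
  obtain ⟨F, hF⟩ := hmap.exists_diffeomorph hL' (hset.trans (L.toSet_map (HyperLie.sigmaEquiv hO)).symm)
  obtain ⟨Ω, hΩ⟩ := h.hypersymplectic L hL
  obtain ⟨Ω', hΩ'⟩ := h.hypersymplectic L' hL'
  have hU : ∀ p, L.incl p ∈ U := fun p => hL.integral.subset ⟨p, rfl⟩
  have hpull :=
    HyperLie.pullsBackTo_of_rotation hΩ hΩ'
      (fun p i => (hL.integral.tangent p).trans (h.foliation _ (hU p) 0 i))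
      (HyperLie.sigmaEquiv hO) F hF hO (fun p k β => h.sigma_sharp hO hneg (hU p) k β)
  exact ⟨F, hF, Ω, Ω', hΩ, hΩ',
    fun hd => ⟨O, Matrix.mem_specialOrthogonalGroup_iff.2 ⟨hO, hd⟩, hpull⟩,
    fun hd => ⟨O, hO, hd, hpull⟩⟩
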